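/- Notation. Points $x\ne y$ of $\mathbb{Z}^2$ are $c_2$-adjacent if $|x_1-y_1|\le 1$ and $|x_2-y_2|\le 1$, and $c_1$-adjacent if $|x_1-y_1|+|x_2-y_2|=1$. For an adjacency $\kappa$, a set is $\kappa$-connected if any two of its points are joined by a $\kappa$-path inside it; a map $f:X\to X$ is $\kappa$-continuous if it maps $\kappa$-connected subsets of $X$ to $\kappa$-connected sets; $A\subset X$ is a freezing set for $(X,\kappa)$ if the only $\kappa$-continuous $f:X\to X$ that fixes every point of $A$ is the identity, and a minimal freezing set if, moreover, no proper subset of $A$ is a freezing set for $(X,\kappa)$. A $c_2$-closed curve is a cyclic sequence $S$ of distinct points of $\mathbb{Z}^2$, each $c_2$-adjacent to the next. Its segments are the runs of at least two consecutive points of $S$ that are collinear; they are horizontal, vertical, or slanted (slope $\pm1$), and a maximal segment (or edge) is one that cannot be prolonged along $S$. If $\mathbb{Z}^2\setminus S$ has exactly two $c_1$-components, one finite and the other infinite, then the union $X$ of $S$ and the finite component is a digital disk and $S$ is a bounding curve of $X$. At a point $p$ of $S$ where two edges meet, the interior angle of $X$ is the angle between them that contains a point of $X$ off the two edges that is $c_2$-adjacent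 to $p$; if there is no such point, it is the smaller angle. The disk $X$ is thick if for some bounding curve $S'$ of $X$: (a) for every point $p$ of a slanted edge of $S'$ that is not an endpoint of this edge there is a point $c\in X$, not on the line through the edge, that is $c_2$-adjacent but not $c_1$-adjacent to $p$; and (b) if $p$ is the vertex of a $135^\circ$ interior angle of $S'$, then there are $b,b'\in X$ in the interior of this angle such that $b$ is $c_2$-adjacent but not $c_1$-adjacent to $p$, and $b'$ is $c_1$-adjacent to $p$. The disk $X$ is (digitally) convex with bounding curve $S$ if the endpoints of the maximal segments of $S$ are exactly the vertices of the convex hull of $X$ in $\mathbb{R}^2$. Theorem. Let $X\subset\mathbb{Z}^2$ be a thick digital disk that is digitally convex with bounding curve $S$. Let $B_1$ be the set of endpoints of the maximal slanted edges of $S$, let $B_2$ be the union of the maximal horizontal and the maximal vertical segments of $S$, and let $B=B_1\cup B_2$. Then $B$ is a minimal freezing set for $(X,c_2)$. -/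

import Mathlib

namespace DigitalPlane

/-- The `c₁`-adjacency (4-adjacency) on `ℤ²`: exactly one coordinate differs, and it differs
by one. -/
def c₁ : SimpleGraph (ℤ × ℤ) where
  Adj x y := |x.1 - y.1| + |x.2 - y.2| = 1
  symm := ⟨fun x y h => by rw [abs_sub_comm y.1, abs_sub_comm y.2]; exact h⟩
  loopless := ⟨fun x h => by simp at h⟩

/-- The `c₂`-adjacency (8-adjacency) on `ℤ²`: distinct points whose coordinates differ by at
most one each. -/
def c₂ : SimpleGraph (ℤ × ℤ) where
  Adj x y := x ≠ y ∧ |x.1 - y.1| ≤ 1 ∧ |x.2 - y.2| ≤ 1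
  symm := ⟨fun x y h => by rw [abs_sub_comm y.1, abs_sub_comm y.2]; exact ⟨h.1.symm, h.2⟩⟩
  loopless := ⟨fun _ h => h.1 rfl⟩

/-- `Y` is `κ`-connected: any two points of `Y` are joined by a `κ`-path inside `Y`. -/
def IsConn (κ : SimpleGraph (ℤ × ℤ)) (Y : Set (ℤ × ℤ)) : Prop :=
  (κ.induce Y).Preconnected

/-- `f ∈ C(X, κ)`: the self-map `f` of `X` takes `κ`-connected subsets of `X` to `κ`-connected
sets. -/
def IsDigCont (κ : SimpleGraph (ℤ × ℤ)) (X : Set (ℤ × ℤ)) (f : X → X) : Prop :=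
  ∀ A : Set X, IsConn κ (Subtype.val '' A) → IsConn κ (Subtype.val '' (f '' A))

/-- `A` is a freezing set for `(X, κ)`: it is a subset of `X`, and the identity is the only
`κ`-continuous self-map of `X` that fixes every point of `A`. -/
def IsFreezing (κ : SimpleGraph (ℤ × ℤ)) (X A : Set (ℤ × ℤ)) : Prop :=
  A ⊆ X ∧ ∀ f : X → X, IsDigCont κ X f → (∀ x : X, (x : ℤ × ℤ) ∈ A → f x = x) → f = id

/-- A minimal freezing set: a freezing set none of whose proper subsets is a freezing set. -/
def IsMinimalFreezing (κ : SimpleGraph (ℤ × ℤ)) (X A : Set (ℤ × ℤ)) : Prop :=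
  Minimal (IsFreezing κ X) A

/-- A `κ`-closed curve with `n ≥ 1` points, indexed cyclically: the points `s 0, …, s (n - 1)` are
distinct and each is adjacent to the next one, the last one to the first. -/
structure IsClosedCurve (κ : SimpleGraph (ℤ × ℤ)) {n : ℕ} (s : ZMod n → ℤ × ℤ) : Prop where
  pos : n ≠ 0
  inj : Function.Injective s
  adj : ∀ i, κ.Adj (s i) (s (i + 1))

/-- `X` is a digital disk with bounding curve `s`: `s` is a `c₂`-closed curve, its complement in
`ℤ²` has exactly two `c₁`-components, one of them (`C`) finite and the other (`E`) infinite, and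
`X` is the union of the curve and the finite component. -/
def IsBoundingCurve {n : ℕ} (s : ZMod n → ℤ × ℤ) (X : Set (ℤ × ℤ)) : Prop :=
  IsClosedCurve c₂ s ∧
  ∃ C E : (c₁.induce (Set.range s)ᶜ).ConnectedComponent,
    C ≠ E ∧ (∀ K, K = C ∨ K = E) ∧ C.supp.Finite ∧ E.supp.Infinite ∧
    X = Set.range s ∪ Subtype.val '' C.supp

/-- The consecutive points `s i, s (i + 1), …, s (i + l)`, `l ≥ 1`, form a digital line segment
of the curve `s`. (Distinct consecutive points of a `c₂`-closed curve are collinear exactly when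
all steps between them are equal.) -/
def IsSegment {n : ℕ} (s : ZMod n → ℤ × ℤ) (i : ZMod n) (l : ℕ) : Prop :=
  1 ≤ l ∧ ∀ j : ℕ, j < l → s (i + j + 1) - s (i + j) = s (i + 1) - s i

/-- The segment `s i, …, s (i + l)` of the curve is maximal: it can be prolonged at neither
end. -/
def IsMaxSegment {n : ℕ} (s : ZMod n → ℤ × ℤ) (i : ZMod n) (l : ℕ) : Prop :=
  IsSegment s i l ∧ ¬ IsSegment s (i - 1) (l + 1) ∧ ¬ IsSegment s i (l + 1)

/-- The step from `s i` to `s (i + 1)` is slanted (slope `1` or `-1`). -/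
def IsSlantedAt {n : ℕ} (s : ZMod n → ℤ × ℤ) (i : ZMod n) : Prop :=
  (s (i + 1)).1 ≠ (s i).1 ∧ (s (i + 1)).2 ≠ (s i).2

/-- The step from `s i` to `s (i + 1)` is horizontal. -/
def IsHorizontalAt {n : ℕ} (s : ZMod n → ℤ × ℤ) (i : ZMod n) : Prop :=
  (s (i + 1)).2 = (s i).2

/-- The step from `s i` to `s (i + 1)` is vertical. -/
def IsVerticalAt {n : ℕ} (s : ZMod n → ℤ × ℤ) (i : ZMod n) : Prop :=
  (s (i + 1)).1 = (s i).1

/-- The set of endpoints of the maximal line segments of the curve `s`. -/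
def segmentEndpoints {n : ℕ} (s : ZMod n → ℤ × ℤ) : Set (ℤ × ℤ) :=
  {x | ∃ i l, IsMaxSegment s i l ∧ (x = s i ∨ x = s (i + l))}

/-- The inclusion of `ℤ²` in the real plane. -/
def toPlane (x : ℤ × ℤ) : ℝ × ℝ := ((x.1 : ℝ), (x.2 : ℝ))

/-- The vertices of the convex hull in the real plane of a set of lattice points. -/
def hullVertices (X : Set (ℤ × ℤ)) : Set (ℝ × ℝ) :=
  (convexHull ℝ (toPlane '' X)).extremePoints ℝ

/-- `X` is a (digitally) convex disk, as witnessed by its bounding curve `s`: the endpoints of the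
maximal line segments of `s` are the vertices of the convex hull of `X`. -/
def IsConvexDisk {n : ℕ} (s : ZMod n → ℤ × ℤ) (X : Set (ℤ × ℤ)) : Prop :=
  IsBoundingCurve s X ∧ toPlane '' segmentEndpoints s = hullVertices X

/-- Cross product of plane lattice vectors. -/
def cross (u v : ℤ × ℤ) : ℤ := u.1 * v.2 - u.2 * v.1

/-- Inner product of plane lattice vectors. -/
def dot (u v : ℤ × ℤ) : ℤ := u.1 * v.1 + u.2 * v.2

/-- For linearly independent `u`, `v`: the point `q` lies in the interior of the angle (of less
than 180°) at `p` between the directions `u` and `v`, that is, `q - p` is a combination of `u` and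
`v` with positive coefficients. -/
def InAngle (p u v q : ℤ × ℤ) : Prop :=
  0 < cross u v * cross u (q - p) ∧ 0 < cross u v * cross (q - p) v

/-- The two sides of the curve at `s i` form a 135° angle. Angles between steps of a `c₂`-closed
curve are multiples of 45°, so 135° means obtuse and not straight. -/
def Is135At {n : ℕ} (s : ZMod n → ℤ × ℤ) (i : ZMod n) : Prop :=
  dot (s (i - 1) - s i) (s (i + 1) - s i) < 0 ∧ cross (s (i - 1) - s i) (s (i + 1) - s i) ≠ 0

/-- `q` lies in the interior of the angle (of less than 180°) at `s i` between the two sides of the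
curve that meet there. -/
def InCurveAngle {n : ℕ} (s : ZMod n → ℤ × ℤ) (i : ZMod n) (q : ℤ × ℤ) : Prop :=
  InAngle (s i) (s (i - 1) - s i) (s (i + 1) - s i) q

/-- The interior angle of `X` at `s i` has 135°. Of the two angles (135° and 225°) formed at `s i`
by the sides of the curve, the interior one is the one that contains a `c₂`-neighbour `q ∈ X` of
`s i` off the two sides, and the smaller one if there is no such `q`. -/
def HasInteriorAngle135 {n : ℕ} (s : ZMod n → ℤ × ℤ) (X : Set (ℤ × ℤ)) (i : ZMod n) : Prop :=
  Is135At s i ∧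
  ((∃ q ∈ X, c₂.Adj q (s i) ∧ InCurveAngle s i q) ∨
    ¬ ∃ q ∈ X, c₂.Adj q (s i) ∧ q ≠ s (i - 1) ∧ q ≠ s (i + 1))

/-- `X` is a thick digital disk. For some bounding curve `s` of `X`:
* for each point `p` of a maximal slanted segment of `s` that is not one of its endpoints there is
  a diagonal neighbour `c ∈ X` of `p` off the line of the segment, that is, other than the two
  neighbours of `p` on the segment;
* if `p` is the vertex of a 135° interior angle, then there are points `b, b' ∈ X` in the interior
  of this angle, `b` a diagonal neighbour of `p` and `b'` a `c₁`-neighbour of `p`. -/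
def IsThick (X : Set (ℤ × ℤ)) : Prop :=
  ∃ (n : ℕ) (s : ZMod n → ℤ × ℤ), IsBoundingCurve s X ∧
    (∀ (i : ZMod n) (l : ℕ), IsMaxSegment s i l → IsSlantedAt s i → ∀ j : ℕ, 0 < j → j < l →
      ∃ c ∈ X, c₂.Adj c (s (i + j)) ∧ ¬ c₁.Adj c (s (i + j)) ∧
        c ≠ s (i + j - 1) ∧ c ≠ s (i + j + 1)) ∧
    (∀ i : ZMod n, HasInteriorAngle135 s X i →
      ∃ b ∈ X, ∃ b' ∈ X, InCurveAngle s i b ∧ InCurveAngle s i b' ∧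
        c₂.Adj b (s i) ∧ ¬ c₁.Adj b (s i) ∧ c₁.Adj b' (s i))

/-- The set of endpoints of the maximal slanted edges of the curve. -/
def slantedEndpoints {n : ℕ} (s : ZMod n → ℤ × ℤ) : Set (ℤ × ℤ) :=
  {x | ∃ i l, IsMaxSegment s i l ∧ IsSlantedAt s i ∧ (x = s i ∨ x = s (i + l))}

/-- The union of the maximal horizontal and the maximal vertical segments of the curve. -/
def axisPoints {n : ℕ} (s : ZMod n → ℤ × ℤ) : Set (ℤ × ℤ) :=
  {x | ∃ i l, IsMaxSegment s i l ∧ (IsHorizontalAt s i ∨ IsVerticalAt s i) ∧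
    ∃ j : ℕ, j ≤ l ∧ x = s (i + j)}

end DigitalPlane

namespace DigitalPlane

/-! ### Continuity for `c₂` and dominated points -/

/-! A map is `c₂`-continuous exactly when it moves neighbours to points that are equal or adjacent,
so it is 1-Lipschitz in each coordinate. If two fixed points on a path differ in a coordinate by the
full length of the path, that coordinate has no slack in between. On a slanted edge both coordinates
are rigid in this way, so fixing `B` fixes the whole curve. Every horizontal or vertical line
through a point of `X` meets the curve on both sides, so the same argument fixes both coordinates of
every point (`IsExposedDisk.isFreezing`).

For minimality, each `b ∈ B` is dominated: some other `q ∈ X` is equal or adjacent to all neighbours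
of `b` in `X`. Sending `b` to `q` and fixing the rest is continuous, so every freezing set contains
`b`.

To find `q`, convexity gives at each edge endpoint a linear functional strictly maximised there, and
puts `X` on one side of each axis-parallel edge. A parity count of crossings
(`IsExposedDisk.below_mem`) then puts the point just inside the curve into `X`. At a vertex where
the count is even, the curve itself supplies `q`, or else a one-point hole would appear. -/

theorem adj_c₂_of_le {x y : ℤ × ℤ} (hne : x ≠ y) (h : |x.1 - y.1| ≤ 1 ∧ |x.2 - y.2| ≤ 1) :
    c₂.Adj x y := ⟨hne, h⟩

theorem isDigCont_c₂_of_forall_adj {X : Set (ℤ × ℤ)} {f : X → X}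
    (hf : ∀ x y : X, c₂.Adj x y →
      |(f x : ℤ × ℤ).1 - (f y : ℤ × ℤ).1| ≤ 1 ∧ |(f x : ℤ × ℤ).2 - (f y : ℤ × ℤ).2| ≤ 1) :
    IsDigCont c₂ X f := by
  rintro A hA ⟨_, _, ⟨a, ha, rfl⟩, rfl⟩ ⟨_, _, ⟨b, hb, rfl⟩, rfl⟩
  have h := (SimpleGraph.reachable_iff_reflTransGen _ _).1
    (hA ⟨a, a, ha, rfl⟩ ⟨b, b, hb, rfl⟩)
  have key : ∀ w : (Subtype.val '' A : Set (ℤ × ℤ)),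
      Relation.ReflTransGen (c₂.induce (Subtype.val '' A)).Adj ⟨a, a, ha, rfl⟩ w →
      ∀ (c : X) (hc : c ∈ A), (c : ℤ × ℤ) = w →
      (c₂.induce (Subtype.val '' (f '' A))).Reachable ⟨f a, f a, ⟨a, ha, rfl⟩, rfl⟩
        ⟨f c, f c, ⟨c, hc, rfl⟩, rfl⟩ := by
    intro w hw
    induction hw with
    | refl =>
      intro c hc h
      obtain rfl : c = a := Subtype.ext h
      exact SimpleGraph.Reachable.refl _
    | @tail v w _ hvw ih =>
      intro c hc h
      obtain ⟨_, d, hd, rfl⟩ := v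
      refine (ih d hd rfl).trans ?_
      have hdc : c₂.Adj d c := by rw [h]; exact hvw
      by_cases hfe : f d = f c
      · simp only [hfe]
        exact SimpleGraph.Reachable.refl _
      · refine SimpleGraph.Adj.reachable ?_
        exact adj_c₂_of_le (fun h => hfe (Subtype.ext h)) (hf d c hdc)
  exact key _ h b hb rfl

/-- The image of the connected pair `{x, y}` is connected and has at most two points. -/
theorem IsDigCont.le_one_of_adj {X : Set (ℤ × ℤ)} {f : X → X} (hf : IsDigCont c₂ X f) {x y : X}
    (hxy : c₂.Adj x y) :
    |(f x : ℤ × ℤ).1 - (f y : ℤ × ℤ).1| ≤ 1 ∧ |(f x : ℤ × ℤ).2 - (f y : ℤ × ℤ).2| ≤ 1 := by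
  have hconn : IsConn c₂ (Subtype.val '' ({x, y} : Set X)) := by
    rintro ⟨_, a, ha, rfl⟩ ⟨_, b, hb, rfl⟩
    rcases ha with rfl | rfl <;> rcases hb with rfl | rfl
    · exact SimpleGraph.Reachable.refl _
    · exact SimpleGraph.Adj.reachable hxy
    · exact SimpleGraph.Adj.reachable hxy.symm
    · exact SimpleGraph.Reachable.refl _
  have h := (SimpleGraph.reachable_iff_reflTransGen _ _).1
    (hf _ hconn ⟨f x, f x, ⟨x, by simp, rfl⟩, rfl⟩ ⟨f y, f y, ⟨y, by simp, rfl⟩, rfl⟩)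
  rcases Relation.ReflTransGen.cases_head h with h | ⟨⟨_, _, ⟨c, hc, rfl⟩, rfl⟩, h, -⟩
  · have : (f x : ℤ × ℤ) = f y := (Subtype.mk.injEq _ _ _ _).mp h
    simp [this]
  · have h' : c₂.Adj (f x) (f c) := h
    rcases hc with rfl | rfl
    · exact absurd h' (c₂.loopless.irrefl _)
    · exact h'.2

/-- Some other point of `X` is equal or `c₂`-adjacent to every `c₂`-neighbour of `b` in `X`. -/
def IsDominated (X : Set (ℤ × ℤ)) (b : ℤ × ℤ) : Prop :=
  ∃ q ∈ X, q ≠ b ∧ ∀ x ∈ X, c₂.Adj b x → |x.1 - q.1| ≤ 1 ∧ |x.2 - q.2| ≤ 1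

/-- If `b ∉ A`, the map moving only `b`, to its dominating point, is continuous, fixes `A`, and is
not the identity. -/
theorem IsDominated.mem_of_isFreezing {X A : Set (ℤ × ℤ)} {b : ℤ × ℤ} (h : IsDominated X b)
    (hb : b ∈ X) (hA : IsFreezing c₂ X A) : b ∈ A := by
  classical
  by_contra hbA
  obtain ⟨q, hq, hqb, hdom⟩ := h
  let f : X → X := fun x => if (x : ℤ × ℤ) = b then ⟨q, hq⟩ else x
  have hf : f = id := by
    refine hA.2 f (isDigCont_c₂_of_forall_adj fun x y hxy => ?_) fun x hx => ?_
    · by_cases hx : (x : ℤ × ℤ) = b <;> by_cases hy : (y : ℤ × ℤ) = b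
      · exact absurd (hx.trans hy.symm) hxy.1
      · have := hdom y y.2 (hx ▸ hxy)
        simp only [f, hx, hy, if_true, if_false]
        rwa [abs_sub_comm q.1, abs_sub_comm q.2]
      · have := hdom x x.2 (hy ▸ hxy.symm)
        simpa only [f, hx, hy, if_true, if_false] using this
      · simpa only [f, hx, hy, if_false] using hxy.2
    · have : (x : ℤ × ℤ) ≠ b := fun h => hbA (h ▸ hx)
      simp [f, this]
  have h1 := congrArg Subtype.val (congrFun hf ⟨b, hb⟩)
  simp only [f, if_true, id] at h1
  exact hqb h1

/-! ### Segments of closed curves -/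

section Segments

variable {n : ℕ} {s : ZMod n → ℤ × ℤ} {i : ZMod n} {l : ℕ}

theorem IsClosedCurve.step_ne_zero (hs : IsClosedCurve c₂ s) (i : ZMod n) :
    s (i + 1) - s i ≠ 0 := fun h => (hs.adj i).1 (sub_eq_zero.1 h).symm

theorem IsSegment.apply (h : IsSegment s i l) {j : ℕ} (hj : j ≤ l) :
    s (i + j) = s i + j • (s (i + 1) - s i) := by
  induction j with
  | zero => simp
  | succ j ih =>
    rw [succ_nsmul, ← add_assoc, ← ih (by omega), ← h.2 j (by omega)]
    push_cast
    rw [← add_assoc]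
    abel

theorem IsSegment.mono {l' : ℕ} (h : IsSegment s i l) (h1 : 1 ≤ l') (h2 : l' ≤ l) :
    IsSegment s i l' := ⟨h1, fun j hj => h.2 j (by omega)⟩

/-- After `n` equal steps the curve would be back at its start, yet displaced by `n` times a nonzero
vector. -/
theorem IsSegment.lt_card (hs : IsClosedCurve c₂ s) (h : IsSegment s i l) : l < n := by
  by_contra hl
  have h1 := h.apply (not_lt.1 hl)
  rw [ZMod.natCast_self, add_zero] at h1
  have h2 : n • (s (i + 1) - s i) = 0 := by simpa using h1
  rcases smul_eq_zero.1 h2 with h3 | h3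
  · exact hs.pos h3
  · exact hs.step_ne_zero i h3

theorem exists_isMaxSegment (hs : IsClosedCurve c₂ s) (i : ZMod n) :
    ∃ (i₀ : ZMod n) (l m : ℕ), IsMaxSegment s i₀ l ∧ m < l ∧ i = i₀ + m := by
  classical
  -- Extend the step from `i` backwards as far as possible, then the result forwards. Segments are
  -- shorter than `n`, so `n` bounds both searches.
  let P : ℕ → Prop := fun m => IsSegment s (i - m) (m + 1)
  have hP0 : P 0 := ⟨by omega, fun j hj => by obtain rfl : j = 0 := by omega
                                              simp⟩
  have hm : P (Nat.findGreatest P n) := Nat.findGreatest_spec (Nat.zero_le _) hP0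
  set m := Nat.findGreatest P n with hmdef
  let Q : ℕ → Prop := IsSegment s (i - m)
  have hQ : Q (m + 1) := hm
  have hmn : m + 1 ≤ n := (IsSegment.lt_card hs hm).le
  have hl : Q (Nat.findGreatest Q n) := Nat.findGreatest_spec hmn hQ
  have hml : m + 1 ≤ Nat.findGreatest Q n := Nat.le_findGreatest hmn hQ
  set l := Nat.findGreatest Q n with hldef
  refine ⟨i - m, l, m, ⟨hl, fun h => ?_, fun h => ?_⟩, hml, by simp⟩
  · have h1 : P (m + 1) := by
      have h2 := h.mono (l' := m + 1 + 1) (by omega) (by omega)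
      have h3 : i - m - 1 = i - ((m + 1 : ℕ) : ZMod n) := by push_cast; ring
      rwa [h3] at h2
    have h2 : m + 1 ≤ n := hmn
    have := Nat.le_findGreatest h2 h1
    omega
  · have := Nat.le_findGreatest (P := Q) (IsSegment.lt_card hs h).le h
    omega

/-- A point of the curve at which the direction changes is the endpoint of a maximal segment. -/
theorem mem_segmentEndpoints_of_step_ne (hs : IsClosedCurve c₂ s)
    (h : s (i + 1) - s i ≠ s i - s (i - 1)) : s i ∈ segmentEndpoints s := by
  obtain ⟨i₀, l, m, hmax, hml, rfl⟩ := exists_isMaxSegment hs i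
  rcases m with _ | m
  · exact ⟨i₀, l, hmax, Or.inl (by simp)⟩
  · refine absurd ?_ h
    have h1 := hmax.1.2 (m + 1) hml
    have h2 := hmax.1.2 m (by omega)
    rw [h1]
    have h3 : i₀ + ((m + 1 : ℕ) : ZMod n) - 1 = i₀ + m := by push_cast; ring
    have h4 : i₀ + ((m + 1 : ℕ) : ZMod n) = i₀ + m + 1 := by push_cast; ring
    rw [h3, h4, h2]

end Segments

/-! ### Extreme points of the hull -/

/-- Deleting an extreme point from the hull leaves a convex set, which contains the hull of the
remaining points. That smaller hull is compact, since `X` is finite, so Hahn–Banach separates it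
strictly from `p`. -/
theorem exists_functional_of_mem_hullVertices {X : Set (ℤ × ℤ)} (hX : X.Finite) {p : ℤ × ℤ}
    (hp : toPlane p ∈ hullVertices X) :
    ∃ α β : ℝ, ∀ x ∈ X, x ≠ p → α * x.1 + β * x.2 < α * p.1 + β * p.2 := by
  have hinj : ∀ x : ℤ × ℤ, toPlane x = toPlane p → x = p := fun x h => by
    simp only [toPlane, Prod.mk.injEq, Int.cast_inj] at h
    exact Prod.ext h.1 h.2
  obtain ⟨-, hconv⟩ := (convex_convexHull ℝ _).mem_extremePoints_iff_convex_sdiff.1 hp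
  have hsub : convexHull ℝ (toPlane '' (X \ {p})) ⊆
      convexHull ℝ (toPlane '' X) \ {toPlane p} := by
    refine convexHull_min ?_ hconv
    rintro _ ⟨x, hx, rfl⟩
    exact ⟨subset_convexHull ℝ _ ⟨x, hx.1, rfl⟩, fun h => hx.2 (hinj x h)⟩
  have hclosed : IsClosed (convexHull ℝ (toPlane '' (X \ {p}))) :=
    ((hX.subset Set.sdiff_subset).image toPlane).isCompact_convexHull (𝕜 := ℝ) |>.isClosed
  obtain ⟨f, u, hf, hu⟩ := geometric_hahn_banach_closed_point (convex_convexHull ℝ _) hclosed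
    (fun h => (hsub h).2 rfl)
  have hexp : ∀ x : ℤ × ℤ, f (toPlane x) = f (1, 0) * x.1 + f (0, 1) * x.2 := fun x => by
    have : toPlane x = (x.1 : ℝ) • ((1, 0) : ℝ × ℝ) + (x.2 : ℝ) • ((0, 1) : ℝ × ℝ) := by
      simp [toPlane]
    rw [this, map_add, map_smul, map_smul, smul_eq_mul, smul_eq_mul]
    ring
  refine ⟨f (1, 0), f (0, 1), fun x hx hne => ?_⟩
  rw [← hexp, ← hexp]
  exact (hf _ (subset_convexHull ℝ _ ⟨x, ⟨hx, hne⟩, rfl⟩)).trans hu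

/-- The properties of a convex disk with bounding curve `s` that decide which of its points are
dominated, in a form that is evidently invariant under the symmetries of `ℤ²`. -/
structure IsExposedDisk {n : ℕ} (s : ZMod n → ℤ × ℤ) (X : Set (ℤ × ℤ)) : Prop where
  curve : IsClosedCurve c₂ s
  range_subset : Set.range s ⊆ X
  finite : X.Finite
  interior : ∃ x ∈ X, x ∉ Set.range s
  /-- A predicate that propagates along `c₁`-adjacencies off the curve is constant off `X`. -/
  outer : ∀ P : ℤ × ℤ → Prop,
    (∀ x y, x ∉ Set.range s → y ∉ Set.range s → c₁.Adj x y → P x → P y) →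
    ∀ x y, x ∉ X → y ∉ X → P x → P y
  inner : ∀ x y, x ∈ X → x ∉ Set.range s → c₁.Adj x y → y ∈ X
  exposed : ∀ p ∈ segmentEndpoints s, ∃ α β : ℝ,
    ∀ x ∈ X, x ≠ p → α * x.1 + β * x.2 < α * p.1 + β * p.2

theorem IsConvexDisk.isExposedDisk {n : ℕ} {s : ZMod n → ℤ × ℤ} {X : Set (ℤ × ℤ)}
    (h : IsConvexDisk s X) : IsExposedDisk s X := by
  obtain ⟨⟨hs, C, E, hCE, hall, hC, hE, rfl⟩, hv⟩ := h
  have : NeZero n := ⟨hs.pos⟩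
  have hfin : (Set.range s ∪ Subtype.val '' C.supp).Finite :=
    (Set.finite_range s).union (hC.image _)
  refine ⟨hs, Set.subset_union_left, hfin, ?_, ?_, ?_, ?_⟩
  · obtain ⟨x, hx⟩ := C.nonempty_supp
    exact ⟨x, Or.inr ⟨x, hx, rfl⟩, x.2⟩
  · intro P hP x y hx hy hPx
    have hmem : ∀ z, z ∉ Set.range s ∪ Subtype.val '' C.supp →
        ∃ hz : z ∈ (Set.range s)ᶜ,
          (c₁.induce (Set.range s)ᶜ).connectedComponentMk ⟨z, hz⟩ = E := by
      intro z hz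
      have hz' : z ∈ (Set.range s)ᶜ := fun h => hz (Or.inl h)
      refine ⟨hz', (hall _).resolve_left fun h => hz (Or.inr ⟨⟨z, hz'⟩, ?_, rfl⟩)⟩
      exact h
    obtain ⟨hx', hxE⟩ := hmem x hx
    obtain ⟨hy', hyE⟩ := hmem y hy
    have hr := (SimpleGraph.reachable_iff_reflTransGen _ _).1
      (SimpleGraph.ConnectedComponent.exact (hxE.trans hyE.symm))
    have key : ∀ w : ((Set.range s)ᶜ : Set (ℤ × ℤ)),
        Relation.ReflTransGen (c₁.induce (Set.range s)ᶜ).Adj ⟨x, hx'⟩ w → P w := by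
      intro w hw
      induction hw with
      | refl => exact hPx
      | @tail v w _ hvw ih => exact hP v w v.2 w.2 hvw ih
    exact key _ hr
  · rintro x y (hx | ⟨⟨x, hxs⟩, hx, rfl⟩) hxs' hxy
    · exact absurd hx hxs'
    · by_cases hy : y ∈ Set.range s
      · exact Or.inl hy
      · refine Or.inr ⟨⟨y, hy⟩, ?_, rfl⟩
        rw [SimpleGraph.ConnectedComponent.mem_supp_iff] at hx ⊢
        rw [← hx]
        exact SimpleGraph.ConnectedComponent.sound
          (SimpleGraph.Adj.reachable (G := c₁.induce (Set.range s)ᶜ) (u := ⟨y, hy⟩) hxy.symm)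
  · intro p hp
    exact exists_functional_of_mem_hullVertices hfin (hv ▸ ⟨p, hp, rfl⟩)

/-! ### The curve and its interior are frozen -/

/-- The two fixed ends differ in `π` by exactly `l`, and `π ∘ F` changes by at most one per step, so
every step must be used in full. -/
theorem coord_eq_of_path {X : Set (ℤ × ℤ)} {F : ℤ × ℤ → ℤ × ℤ} {π : ℤ × ℤ → ℤ}
    (hF : ∀ x ∈ X, ∀ y ∈ X, c₂.Adj x y → |π (F x) - π (F y)| ≤ 1) {p : ℕ → ℤ × ℤ} {l : ℕ}
    (hp : ∀ j ≤ l, p j ∈ X) (hadj : ∀ j < l, c₂.Adj (p j) (p (j + 1))) {ε : ℤ}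
    (hε : ε = 1 ∨ ε = -1) (hπ : ∀ j ≤ l, π (p j) = π (p 0) + ε * j)
    (h₀ : F (p 0) = p 0) (hl : F (p l) = p l) {j : ℕ} (hj : j ≤ l) : π (F (p j)) = π (p j) := by
  have key : ∀ k i : ℕ, i + k ≤ l → |π (F (p i)) - π (F (p (i + k)))| ≤ k := by
    intro k
    induction k with
    | zero => intro i _; simp
    | succ k ih =>
      intro i hi
      have h1 := ih i (by omega)
      have h2 := hF _ (hp (i + k) (by omega)) _ (hp (i + k + 1) (by omega))
        (hadj (i + k) (by omega))
      rw [abs_le] at h1 h2 ⊢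
      rw [← add_assoc]
      push_cast
      constructor <;> linarith [h1.1, h1.2, h2.1, h2.2]
  obtain ⟨k, rfl⟩ := Nat.exists_eq_add_of_le hj
  have h1 := key j 0 (by omega)
  have h2 := key k j le_rfl
  have h3 := hπ j hj
  have h4 := hπ (j + k) le_rfl
  rw [zero_add, h₀] at h1
  rw [hl] at h2
  rw [abs_le] at h1 h2
  push_cast at h4
  rcases hε with rfl | rfl
  · linarith [h1.1, h1.2, h2.1, h2.2]
  · linarith [h1.1, h1.2, h2.1, h2.2]

variable {n : ℕ} {s : ZMod n → ℤ × ℤ} {X : Set (ℤ × ℤ)}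

theorem c₁_adj_add_iff {x d : ℤ × ℤ} : c₁.Adj x (x + d) ↔ |d.1| + |d.2| = 1 := by
  have : c₁.Adj x (x + d) ↔ |x.1 - (x + d).1| + |x.2 - (x + d).2| = 1 := Iff.rfl
  rw [this]
  simp

/-- A point of the disk sees the curve in each of the four coordinate directions. -/
theorem IsExposedDisk.exists_mem_range (h : IsExposedDisk s X) {x : ℤ × ℤ} (hx : x ∈ X)
    {d : ℤ × ℤ} (hd : |d.1| + |d.2| = 1) :
    ∃ k : ℕ, x + k • d ∈ Set.range s ∧ ∀ j ≤ k, x + j • d ∈ X := by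
  classical
  have hstep : ∀ k : ℕ, (∀ j < k, x + j • d ∉ Set.range s) → ∀ j ≤ k, x + j • d ∈ X := by
    intro k hk j
    induction j with
    | zero => intro _; simpa using hx
    | succ j ih =>
      intro hj
      refine h.inner _ _ (ih (by omega)) (hk j (by omega)) ?_
      rw [succ_nsmul, ← add_assoc]
      exact c₁_adj_add_iff.2 hd
  have hex : ∃ k : ℕ, x + k • d ∈ Set.range s := by
    by_contra hno
    push Not at hno
    have hall : ∀ k : ℕ, x + k • d ∈ X := fun k => hstep k (fun j _ => hno j) k le_rfl
    refine Set.infinite_of_injective_forall_mem (f := fun k : ℕ => x + k • d) ?_ hall h.finite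
    intro a b hab
    have hab' : a • d = b • d := add_left_cancel hab
    have h1 : (a : ℤ) * d.1 = b * d.1 := by simpa using congrArg Prod.fst hab'
    have h2 : (a : ℤ) * d.2 = b * d.2 := by simpa using congrArg Prod.snd hab'
    by_cases h0 : d.1 = 0
    · have h0' : d.2 ≠ 0 := fun e => by simp [h0, e] at hd
      exact_mod_cast mul_right_cancel₀ h0' h2
    · exact_mod_cast mul_right_cancel₀ h0 h1
  exact ⟨Nat.find hex, Nat.find_spec hex, hstep _ fun j hj => Nat.find_min hex hj⟩

/-- A `c₂`-Lipschitz map fixing the curve preserves the coordinate `π` along lines in the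
direction `d`. -/
theorem IsExposedDisk.coord_eq (h : IsExposedDisk s X) {F : ℤ × ℤ → ℤ × ℤ} {π : ℤ × ℤ →+ ℤ}
    (hF : ∀ x ∈ X, ∀ y ∈ X, c₂.Adj x y → |π (F x) - π (F y)| ≤ 1)
    (hfix : ∀ x ∈ Set.range s, F x = x) {d : ℤ × ℤ} (hd : |d.1| + |d.2| = 1) (hπ : π d = 1)
    {x : ℤ × ℤ} (hx : x ∈ X) : π (F x) = π x := by
  obtain ⟨k, hk, hkX⟩ := h.exists_mem_range hx hd
  obtain ⟨m, hm, hmX⟩ := h.exists_mem_range hx (d := -d) (by simpa using hd)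
  -- The path runs from the curve point behind `x` to the one ahead. Membership in `X` is known
  -- along the two rays from `x`, so its points are rewritten relative to `x`.
  have hval : ∀ j : ℕ, m ≤ j → x + m • (-d) + j • d = x + (j - m) • d := by
    intro j hj
    obtain ⟨t, rfl⟩ := Nat.exists_eq_add_of_le hj
    rw [Nat.add_sub_cancel_left, add_nsmul, smul_neg]
    abel
  have hval' : ∀ j : ℕ, j ≤ m → x + m • (-d) + j • d = x + (m - j) • (-d) := by
    intro j hj
    obtain ⟨t, rfl⟩ := Nat.exists_eq_add_of_le hj
    rw [Nat.add_sub_cancel_left, add_nsmul, smul_neg, smul_neg]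
    abel
  have hd2 : ∀ y : ℤ × ℤ, c₂.Adj y (y + d) := by
    intro y
    refine adj_c₂_of_le (fun e => ?_) ?_
    · have : d = 0 := by simpa using e
      simp [this] at hd
    · have h1 := abs_nonneg d.1
      have h2 := abs_nonneg d.2
      simp only [Prod.fst_add, Prod.snd_add, sub_add_cancel_left, abs_neg]
      omega
  have := coord_eq_of_path (X := X) (F := F) (π := π) hF
    (p := fun j => x + m • (-d) + j • d) (l := m + k) (ε := 1) ?_ ?_ (Or.inl rfl) ?_ ?_ ?_
    (Nat.le_add_right m k)
  · simpa using this
  · intro j hj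
    rcases le_total m j with hmj | hmj
    · simpa only [hval j hmj] using hkX _ (by omega)
    · simpa only [hval' j hmj] using hmX _ (by omega)
  · intro j _
    simp only [succ_nsmul, ← add_assoc]
    exact hd2 _
  · intro j _
    simp [-nsmul_eq_mul, map_nsmul, hπ]
  · simpa using hfix _ hm
  · have : x + m • (-d) + (m + k) • d = x + k • d := by
      rw [hval _ (by omega), Nat.add_sub_cancel_left]
    simpa only [this] using hfix _ hk

theorem IsExposedDisk.boundary_subset (h : IsExposedDisk s X) :
    slantedEndpoints s ∪ axisPoints s ⊆ X := by
  rintro x (⟨i, l, -, -, rfl | rfl⟩ | ⟨i, l, -, -, j, -, rfl⟩) <;>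
    exact h.range_subset (Set.mem_range_self _)

theorem abs_eq_one_cases {a : ℤ} (h : |a| ≤ 1) (h0 : a ≠ 0) : a = 1 ∨ a = -1 := by
  rw [abs_le] at h
  omega

theorem IsExposedDisk.isFreezing (h : IsExposedDisk s X) :
    IsFreezing c₂ X (slantedEndpoints s ∪ axisPoints s) := by
  classical
  refine ⟨h.boundary_subset, fun f hf hfix => ?_⟩
  let F : ℤ × ℤ → ℤ × ℤ := fun x => if hx : x ∈ X then f ⟨x, hx⟩ else x
  have hFX : ∀ x : X, F x = f x := fun x => by simp [F]
  have hF : ∀ x ∈ X, ∀ y ∈ X, c₂.Adj x y → |(F x).1 - (F y).1| ≤ 1 ∧ |(F x).2 - (F y).2| ≤ 1 := by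
    intro x hx y hy hxy
    have := hf.le_one_of_adj (x := ⟨x, hx⟩) (y := ⟨y, hy⟩) hxy
    rwa [← hFX, ← hFX] at this
  have hFB : ∀ x ∈ slantedEndpoints s ∪ axisPoints s, F x = x := fun x hx => by
    have := hFX ⟨x, h.boundary_subset hx⟩
    rw [hfix _ hx] at this
    exact this
  have hFS : ∀ x ∈ Set.range s, F x = x := by
    rintro _ ⟨i, rfl⟩
    obtain ⟨i, l, m, hmax, hml, rfl⟩ := exists_isMaxSegment h.curve i
    by_cases hax : IsHorizontalAt s i ∨ IsVerticalAt s i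
    · exact hFB _ (Or.inr ⟨i, l, hmax, hax, m, hml.le, rfl⟩)
    · have hsl : IsSlantedAt s i := ⟨fun e => hax (Or.inr e), fun e => hax (Or.inl e)⟩
      have h₀ : F (s i) = s i := hFB _ (Or.inl ⟨i, l, hmax, hsl, Or.inl rfl⟩)
      have hl : F (s (i + l)) = s (i + l) := hFB _ (Or.inl ⟨i, l, hmax, hsl, Or.inr rfl⟩)
      obtain ⟨-, ha1, ha2⟩ := h.curve.adj i
      rw [abs_sub_comm] at ha1 ha2
      have hX : ∀ j ≤ l, s (i + (j : ℕ)) ∈ X := fun j _ => h.range_subset (Set.mem_range_self _)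
      have hadj : ∀ j < l, c₂.Adj (s (i + (j : ℕ))) (s (i + ((j + 1 : ℕ) : ZMod n))) := by
        intro j _
        have := h.curve.adj (i + j)
        rwa [add_assoc, ← Nat.cast_add_one] at this
      -- On a slanted edge each coordinate changes by a constant `±1` per step, so both are rigid
      -- between the fixed endpoints.
      refine Prod.ext ?_ ?_
      · refine coord_eq_of_path (π := Prod.fst) (p := fun j => s (i + (j : ℕ)))
          (fun x hx y hy hxy => (hF x hx y hy hxy).1) hX hadj
          (abs_eq_one_cases ha1 (sub_ne_zero.2 hsl.1)) (fun j hj => ?_) (by simpa using h₀) hl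
          hml.le
        simp only [hmax.1.apply hj, Nat.cast_zero, add_zero, Prod.fst_add, Prod.smul_fst,
          Prod.fst_sub]
        rw [nsmul_eq_mul, mul_comm]
      · refine coord_eq_of_path (π := Prod.snd) (p := fun j => s (i + (j : ℕ)))
          (fun x hx y hy hxy => (hF x hx y hy hxy).2) hX hadj
          (abs_eq_one_cases ha2 (sub_ne_zero.2 hsl.2)) (fun j hj => ?_) (by simpa using h₀) hl
          hml.le
        simp only [hmax.1.apply hj, Nat.cast_zero, add_zero, Prod.snd_add, Prod.smul_snd,
          Prod.snd_sub]
        rw [nsmul_eq_mul, mul_comm]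
  funext x
  refine Subtype.ext ?_
  rw [← hFX]
  exact Prod.ext
    (h.coord_eq (π := AddMonoidHom.fst ℤ ℤ) (fun x hx y hy hxy => (hF x hx y hy hxy).1) hFS
      (d := (1, 0)) (by simp) rfl x.2)
    (h.coord_eq (π := AddMonoidHom.snd ℤ ℤ) (fun x hx y hy hxy => (hF x hx y hy hxy).2) hFS
      (d := (0, 1)) (by simp) rfl x.2)

/-! ### Parity of the number of steps above a point -/

open Classical in
/-- The parity of the number of steps of the curve from a point straight above `p` to the next
column on the right. -/
noncomputable def rightStepsAbove (s : ZMod n → ℤ × ℤ) [NeZero n] (p : ℤ × ℤ) : ZMod 2 :=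
  ∑ k, if (s k).1 = p.1 ∧ p.2 < (s k).2 then
    ((if (s (k + 1)).1 = p.1 + 1 then 1 else 0) + if (s (k - 1)).1 = p.1 + 1 then 1 else 0) else 0

theorem rightStepsAbove_up [NeZero n] {p q : ℤ × ℤ} (h1 : q.1 = p.1) (h2 : q.2 = p.2 + 1)
    (hq : q ∉ Set.range s) : rightStepsAbove s p = rightStepsAbove s q := by
  refine Finset.sum_congr rfl fun k _ => ?_
  have : ((s k).1 = p.1 ∧ p.2 < (s k).2) ↔ ((s k).1 = q.1 ∧ q.2 < (s k).2) := by
    have hk : ¬ ((s k).1 = q.1 ∧ (s k).2 = q.2) := fun e => hq ⟨k, Prod.ext e.1 e.2⟩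
    omega
  simp only [this, h1]

/-- Each curve point above `q` has two steps: to the left column, within its own column, or to the
right. Steps within the column are counted from both ends, so modulo 2 those to the right and those
to the left agree. -/
theorem rightStepsAbove_right [NeZero n] (hs : IsClosedCurve c₂ s) {p q : ℤ × ℤ}
    (h1 : q.1 = p.1 + 1) (h2 : q.2 = p.2) (hp : p ∉ Set.range s) (hq : q ∉ Set.range s) :
    rightStepsAbove s p = rightStepsAbove s q := by
  classical
  let a : ZMod n → ZMod 2 := fun k => if (s k).1 = p.1 ∧ p.2 < (s k).2 then 1 else 0
  let b : ZMod n → ZMod 2 := fun k => if (s k).1 = q.1 ∧ q.2 < (s k).2 then 1 else 0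
  have hp' : ∀ k, ¬ ((s k).1 = p.1 ∧ (s k).2 = p.2) := fun k e => hp ⟨k, Prod.ext e.1 e.2⟩
  have hq' : ∀ k, ¬ ((s k).1 = q.1 ∧ (s k).2 = q.2) := fun k e => hq ⟨k, Prod.ext e.1 e.2⟩
  have hadj : ∀ k, |(s k).1 - (s (k + 1)).1| ≤ 1 ∧ |(s k).2 - (s (k + 1)).2| ≤ 1 :=
    fun k => (hs.adj k).2
  have hadj' : ∀ k, |(s k).1 - (s (k - 1)).1| ≤ 1 ∧ |(s k).2 - (s (k - 1)).2| ≤ 1 := fun k => by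
    have := hadj (k - 1)
    rwa [sub_add_cancel, abs_sub_comm, abs_sub_comm (s (k - 1)).2] at this
  have h2z : (1 : ZMod 2) + 1 = 0 := rfl
  have hA : ∀ k m, |(s k).1 - (s m).1| ≤ 1 ∧ |(s k).2 - (s m).2| ≤ 1 →
      (a k * if (s m).1 = p.1 + 1 then 1 else 0) = a k * b m := by
    intro k m hkm
    simp only [abs_le] at hkm
    by_cases hk : (s k).1 = p.1 ∧ p.2 < (s k).2
    · have : (s m).1 = p.1 + 1 ↔ ((s m).1 = q.1 ∧ q.2 < (s m).2) := by
        have := hq' m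
        omega
      simp only [b, this]
    · simp [a, hk]
  -- Exactly one of the three directions occurs, so modulo 2 the indicator of "right" is one plus
  -- the other two. Since `p` and `q` are off the curve, a step into either column cannot end at or
  -- below their height.
  have hB : ∀ k m, |(s k).1 - (s m).1| ≤ 1 ∧ |(s k).2 - (s m).2| ≤ 1 →
      (b k * if (s m).1 = q.1 + 1 then 1 else 0) = b k * (1 + a m + b m) := by
    intro k m hkm
    simp only [abs_le] at hkm
    by_cases hk : (s k).1 = q.1 ∧ q.2 < (s k).2
    · have hpm := hp' m
      have hqm := hq' m
      by_cases h3 : (s m).1 = q.1 + 1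
      · have ha : ¬ ((s m).1 = p.1 ∧ p.2 < (s m).2) := by omega
        have hb : ¬ ((s m).1 = q.1 ∧ q.2 < (s m).2) := by omega
        simp only [a, b, if_neg ha, if_neg hb, if_pos h3, add_zero]
      · by_cases h4 : (s m).1 = q.1
        · have ha : ¬ ((s m).1 = p.1 ∧ p.2 < (s m).2) := by omega
          have hb : (s m).1 = q.1 ∧ q.2 < (s m).2 := by omega
          simp only [a, b, if_neg ha, if_pos hb, if_neg h3, add_zero, h2z]
        · have ha : (s m).1 = p.1 ∧ p.2 < (s m).2 := by omega
          have hb : ¬ ((s m).1 = q.1 ∧ q.2 < (s m).2) := by omega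
          simp only [a, b, if_pos ha, if_neg hb, if_neg h3, add_zero, h2z]
    · simp [b, hk]
  have hshift : ∀ u v : ZMod n → ZMod 2, ∑ k, u k * v (k - 1) = ∑ k, u (k + 1) * v k := by
    intro u v
    rw [← Equiv.sum_comp (Equiv.addRight (1 : ZMod n))]
    simp
  have hN : rightStepsAbove s p = ∑ k, a k * b (k + 1) + ∑ k, a (k + 1) * b k := by
    rw [← hshift, ← Finset.sum_add_distrib]
    refine Finset.sum_congr rfl fun k _ => ?_
    rw [← hA k _ (hadj k), ← hA k _ (hadj' k), ← mul_add]
    simp only [a, ite_mul, one_mul, zero_mul]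
  have hN' : rightStepsAbove s q =
      ∑ k, b k * (1 + a (k + 1) + b (k + 1)) + ∑ k, b k * (1 + a (k - 1) + b (k - 1)) := by
    rw [← Finset.sum_add_distrib]
    refine Finset.sum_congr rfl fun k _ => ?_
    rw [← hB k _ (hadj k), ← hB k _ (hadj' k), ← mul_add]
    simp only [b, ite_mul, one_mul, zero_mul]
  rw [hN, hN']
  simp only [mul_add, mul_one, Finset.sum_add_distrib, hshift]
  have e1 : ∑ k, b (k + 1) * b k = ∑ k, b k * b (k + 1) :=
    Finset.sum_congr rfl fun k _ => mul_comm _ _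
  have e2 : ∑ k, b (k + 1) * a k = ∑ k, a k * b (k + 1) :=
    Finset.sum_congr rfl fun k _ => mul_comm _ _
  have e3 : ∑ k, b k * a (k + 1) = ∑ k, a (k + 1) * b k :=
    Finset.sum_congr rfl fun k _ => mul_comm _ _
  rw [e1, e2, e3]
  linear_combination (-(∑ k, b k) - ∑ k, b k * b (k + 1)) * h2z

/-- If `s i` is the highest point of the curve in its column and exactly one of the two steps at
`s i` leads to the column on the right, then the point below `s i` belongs to the disk. -/
theorem IsExposedDisk.below_mem (h : IsExposedDisk s X) {i : ZMod n} {q : ℤ × ℤ}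
    (hq1 : q.1 = (s i).1) (hq2 : q.2 = (s i).2 - 1)
    (htop : ∀ k, (s k).1 = (s i).1 → (s k).2 ≤ (s i).2)
    (hodd : ¬ ((s (i + 1)).1 = (s i).1 + 1 ↔ (s (i - 1)).1 = (s i).1 + 1)) : q ∈ X := by
  classical
  have : NeZero n := ⟨h.curve.pos⟩
  by_contra hqX
  have hinv : ∀ x y, x ∉ Set.range s → y ∉ Set.range s → c₁.Adj x y →
      rightStepsAbove s x = 0 → rightStepsAbove s y = 0 := by
    intro x y hx hy hxy h0
    have hxy' : |x.1 - y.1| + |x.2 - y.2| = 1 := hxy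
    have : (y.1 = x.1 ∧ y.2 = x.2 + 1) ∨ (x.1 = y.1 ∧ x.2 = y.2 + 1) ∨
        (y.1 = x.1 + 1 ∧ y.2 = x.2) ∨ (x.1 = y.1 + 1 ∧ x.2 = y.2) := by
      rcases abs_cases (x.1 - y.1) with h1 | h1 <;> rcases abs_cases (x.2 - y.2) with h2 | h2 <;>
        omega
    rcases this with ⟨h1, h2⟩ | ⟨h1, h2⟩ | ⟨h1, h2⟩ | ⟨h1, h2⟩
    · rwa [← rightStepsAbove_up h1 h2 hy]
    · rwa [rightStepsAbove_up h1 h2 hx]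
    · rwa [← rightStepsAbove_right h.curve h1 h2 hx hy]
    · rwa [rightStepsAbove_right h.curve h1 h2 hy hx]
  obtain ⟨M, hM⟩ := (h.finite.image Prod.snd).bddAbove
  have hM' : ∀ x ∈ X, x.2 ≤ M := fun x hx => hM ⟨x, hx, rfl⟩
  -- No curve point lies above this one, so its count is zero.
  have hfar : ((0, M + 1) : ℤ × ℤ) ∉ X := fun hx => by simpa using hM' _ hx
  have h0 : rightStepsAbove s (0, M + 1) = 0 := by
    refine Finset.sum_eq_zero fun k _ => if_neg fun hk => ?_
    have := hM' _ (h.range_subset (Set.mem_range_self k))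
    have := hk.2
    simp only at this
    omega
  have hq0 := h.outer (fun x => rightStepsAbove s x = 0) hinv _ _ hfar hqX h0
  have : rightStepsAbove s q = (if (s (i + 1)).1 = (s i).1 + 1 then 1 else 0) +
      if (s (i - 1)).1 = (s i).1 + 1 then 1 else 0 := by
    unfold rightStepsAbove
    rw [Finset.sum_eq_single i, if_pos ⟨hq1.symm, by omega⟩, hq1]
    · intro k _ hk
      refine if_neg fun ⟨h1, h2⟩ => hk (h.curve.inj (Prod.ext (h1.trans hq1) ?_))
      have := htop k (h1.trans hq1)
      omega
    · simp
  simp only [this] at hq0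
  apply hodd
  split_ifs at hq0 with h1 h2 h2
  · exact iff_of_true h1 h2
  · simp at hq0
  · simp at hq0
  · exact iff_of_false h1 h2

/-! ### Symmetries of the digital plane -/

/-- An additive automorphism of `ℤ²` preserving both adjacencies; it carries linear functionals
to linear functionals. -/
structure IsSymmetry (g : ℤ × ℤ ≃+ ℤ × ℤ) : Prop where
  adj_c₁ : ∀ x y, c₁.Adj (g x) (g y) ↔ c₁.Adj x y
  adj_c₂ : ∀ x y, c₂.Adj (g x) (g y) ↔ c₂.Adj x y
  functional : ∀ α β : ℝ, ∃ α' β' : ℝ, ∀ x, α' * (g x).1 + β' * (g x).2 = α * x.1 + β * x.2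

theorem c₁_adj_iff {x y : ℤ × ℤ} : c₁.Adj x y ↔ |x.1 - y.1| + |x.2 - y.2| = 1 := Iff.rfl

theorem c₂_adj_iff {x y : ℤ × ℤ} :
    c₂.Adj x y ↔ x ≠ y ∧ |x.1 - y.1| ≤ 1 ∧ |x.2 - y.2| ≤ 1 := Iff.rfl

/-- The symmetry `(a, b) ↦ (b, a)`. -/
def swapAxes : ℤ × ℤ ≃+ ℤ × ℤ := AddEquiv.prodComm

/-- The symmetry `(a, b) ↦ (-a, b)`. -/
def negFst : ℤ × ℤ ≃+ ℤ × ℤ := AddEquiv.prodCongr (AddEquiv.neg ℤ) (AddEquiv.refl ℤ)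

/-- The symmetry `(a, b) ↦ (a, -b)`. -/
def negSnd : ℤ × ℤ ≃+ ℤ × ℤ := AddEquiv.prodCongr (AddEquiv.refl ℤ) (AddEquiv.neg ℤ)

@[simp] theorem swapAxes_fst (x : ℤ × ℤ) : (swapAxes x).1 = x.2 := rfl
@[simp] theorem swapAxes_snd (x : ℤ × ℤ) : (swapAxes x).2 = x.1 := rfl
@[simp] theorem negFst_fst (x : ℤ × ℤ) : (negFst x).1 = -x.1 := rfl
@[simp] theorem negFst_snd (x : ℤ × ℤ) : (negFst x).2 = x.2 := rfl
@[simp] theorem negSnd_fst (x : ℤ × ℤ) : (negSnd x).1 = x.1 := rfl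
@[simp] theorem negSnd_snd (x : ℤ × ℤ) : (negSnd x).2 = -x.2 := rfl

theorem abs_neg_add_eq (a b : ℤ) : |-a + b| = |a - b| := by
  rw [neg_add_eq_sub, abs_sub_comm]

theorem isSymmetry_swapAxes : IsSymmetry swapAxes where
  adj_c₁ x y := by simp [c₁_adj_iff, add_comm]
  adj_c₂ x y := by simp [c₂_adj_iff, and_comm]
  functional α β := ⟨β, α, fun x => by simp [add_comm]⟩

theorem isSymmetry_negFst : IsSymmetry negFst where
  adj_c₁ x y := by simp [c₁_adj_iff, abs_neg_add_eq]
  adj_c₂ x y := by simp [c₂_adj_iff, abs_neg_add_eq]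
  functional α β := ⟨-α, β, fun x => by simp⟩

theorem isSymmetry_negSnd : IsSymmetry negSnd where
  adj_c₁ x y := by simp [c₁_adj_iff, abs_neg_add_eq]
  adj_c₂ x y := by simp [c₂_adj_iff, abs_neg_add_eq]
  functional α β := ⟨α, -β, fun x => by simp⟩

theorem isSegment_comp_iff (g : ℤ × ℤ ≃+ ℤ × ℤ) {i : ZMod n} {l : ℕ} :
    IsSegment (g ∘ s) i l ↔ IsSegment s i l := by
  simp only [IsSegment, Function.comp_apply, ← map_sub, g.injective.eq_iff]

theorem isMaxSegment_comp_iff (g : ℤ × ℤ ≃+ ℤ × ℤ) {i : ZMod n} {l : ℕ} :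
    IsMaxSegment (g ∘ s) i l ↔ IsMaxSegment s i l := by
  simp only [IsMaxSegment, isSegment_comp_iff]

theorem IsExposedDisk.map (h : IsExposedDisk s X) {g : ℤ × ℤ ≃+ ℤ × ℤ} (hg : IsSymmetry g) :
    IsExposedDisk (g ∘ s) (g '' X) := by
  have hr : ∀ x, g x ∈ Set.range (g ∘ s) ↔ x ∈ Set.range s := fun x => by
    simp only [Set.mem_range, Function.comp_apply, g.injective.eq_iff]
  have hX : ∀ x, g x ∈ g '' X ↔ x ∈ X := fun x => g.injective.mem_set_image
  refine ⟨⟨h.curve.pos, g.injective.comp h.curve.inj, fun i => (hg.adj_c₂ _ _).2 (h.curve.adj i)⟩,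
    ?_, h.finite.image g, ?_, ?_, ?_, ?_⟩
  · rw [Set.range_comp]
    exact Set.image_mono h.range_subset
  · obtain ⟨x, hx, hxs⟩ := h.interior
    exact ⟨g x, ⟨x, hx, rfl⟩, fun e => hxs ((hr x).1 e)⟩
  · intro P hP x y hx hy hPx
    obtain ⟨x, rfl⟩ := g.surjective x
    obtain ⟨y, rfl⟩ := g.surjective y
    rw [hX] at hx hy
    refine h.outer (fun z => P (g z)) (fun a b ha hb hab => ?_) x y hx hy hPx
    exact hP _ _ (fun e => ha ((hr a).1 e)) (fun e => hb ((hr b).1 e)) ((hg.adj_c₁ _ _).2 hab)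
  · intro x y hx hxs hxy
    obtain ⟨x, rfl⟩ := g.surjective x
    obtain ⟨y, rfl⟩ := g.surjective y
    rw [hX] at hx ⊢
    exact h.inner x y hx (fun e => hxs ((hr x).2 e)) ((hg.adj_c₁ _ _).1 hxy)
  · rintro p ⟨i, l, hmax, hp⟩
    obtain ⟨p, rfl⟩ := g.surjective p
    have hp' : p ∈ segmentEndpoints s :=
      ⟨i, l, (isMaxSegment_comp_iff g).1 hmax, hp.imp (fun e => g.injective e)
        fun e => g.injective e⟩
    obtain ⟨α, β, hαβ⟩ := h.exposed p hp'
    obtain ⟨α', β', hg'⟩ := hg.functional α β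
    refine ⟨α', β', ?_⟩
    rintro _ ⟨x, hx, rfl⟩ hne
    rw [hg', hg']
    exact hαβ x hx fun e => hne (e ▸ rfl)

theorem abs_sub_le_one_iff {x y : ℤ × ℤ} :
    (|x.1 - y.1| ≤ 1 ∧ |x.2 - y.2| ≤ 1) ↔ x = y ∨ c₂.Adj x y := by
  rw [c₂_adj_iff]
  by_cases h : x = y <;> simp [h]

/-- This reduces vertices to functionals with `0 ≤ α ≤ β`, and axis-parallel edges to top edges. -/
theorem IsDominated.of_map {g : ℤ × ℤ ≃+ ℤ × ℤ} (hg : IsSymmetry g) {b : ℤ × ℤ}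
    (h : IsDominated (g '' X) (g b)) : IsDominated X b := by
  obtain ⟨_, ⟨q, hq, rfl⟩, hqb, hdom⟩ := h
  refine ⟨q, hq, fun e => hqb (e ▸ rfl), fun x hx hbx => ?_⟩
  have := hdom (g x) ⟨x, hx, rfl⟩ ((hg.adj_c₂ _ _).2 hbx)
  rw [abs_sub_le_one_iff, g.injective.eq_iff, hg.adj_c₂] at this
  exact abs_sub_le_one_iff.2 this

/-! ### Vertices are dominated -/

/-- Equality would force `n ≤ 2`, but a point inside the curve sees distinct curve points to its
right, to its left and above. -/
theorem IsExposedDisk.prev_ne_next (h : IsExposedDisk s X) (i : ZMod n) :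
    s (i + 1) ≠ s (i - 1) := by
  intro e
  have e' : i + 1 = i - 1 := h.curve.inj e
  have h2 : ((2 : ℕ) : ZMod n) = 0 := by
    push_cast
    linear_combination e'
  have hn : n ≤ 2 := Nat.le_of_dvd (by norm_num) ((ZMod.natCast_eq_zero_iff 2 n).1 h2)
  have : NeZero n := ⟨h.curve.pos⟩
  obtain ⟨x, hx, hxs⟩ := h.interior
  obtain ⟨k, ⟨a, ha⟩, -⟩ := h.exists_mem_range hx (d := (1, 0)) (by simp)
  obtain ⟨m, ⟨b, hb⟩, -⟩ := h.exists_mem_range hx (d := (-1, 0)) (by simp)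
  obtain ⟨t, ⟨c, hc⟩, -⟩ := h.exists_mem_range hx (d := (0, 1)) (by simp)
  have ha0 := congrArg Prod.fst ha
  have hb0 := congrArg Prod.fst hb
  have hc0 := congrArg Prod.fst hc
  have hk0 : k ≠ 0 := by rintro rfl; exact hxs ⟨a, by simpa using ha⟩
  have hm0 : m ≠ 0 := by rintro rfl; exact hxs ⟨b, by simpa using hb⟩
  rw [Prod.fst_add, Prod.smul_fst, nsmul_eq_mul] at ha0 hb0 hc0
  simp only [mul_one, mul_zero, mul_neg] at ha0 hb0 hc0
  have hab : a ≠ b := by rintro rfl; omega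
  have hac : a ≠ c := by rintro rfl; omega
  have hbc : b ≠ c := by rintro rfl; omega
  have hcard : ({a, b, c} : Finset (ZMod n)).card = 3 := Finset.card_eq_three.2
    ⟨a, b, c, hab, hac, hbc, rfl⟩
  have := Finset.card_le_univ ({a, b, c} : Finset (ZMod n))
  rw [hcard, ZMod.card] at this
  omega

theorem IsClosedCurve.adj_pred (hs : IsClosedCurve c₂ s) (i : ZMod n) :
    c₂.Adj (s i) (s (i - 1)) := by
  have := hs.adj (i - 1)
  rw [sub_add_cancel] at this
  exact this.symm

/-- A point off the disk has a `c₁`-neighbour off the curve. -/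
theorem IsExposedDisk.exists_adj_notMem_range (h : IsExposedDisk s X) {q : ℤ × ℤ} (hq : q ∉ X) :
    ∃ y, c₁.Adj q y ∧ y ∉ Set.range s := by
  by_contra! hno
  -- If all four neighbours were on the curve, `q` would be the only point off `X`, making the plane
  -- finite.
  have hall := h.outer (fun x => x = q) (fun x y _ hy hxy hx => absurd (hno y (hx ▸ hxy)) hy) q
  refine Set.infinite_univ.not_finite ((h.finite.insert q).subset fun y _ => ?_)
  by_cases hy : y ∈ X
  · exact Or.inr hy
  · exact Or.inl (hall y hq hy rfl)

theorem c₂_adj_cases {b x : ℤ × ℤ} (h : c₂.Adj b x) :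
    (x.1 = b.1 - 1 ∨ x.1 = b.1 ∨ x.1 = b.1 + 1) ∧ (x.2 = b.2 - 1 ∨ x.2 = b.2 ∨ x.2 = b.2 + 1) ∧
      ¬ (x.1 = b.1 ∧ x.2 = b.2) := by
  obtain ⟨h0, h1, h2⟩ := h
  rw [abs_le] at h1 h2
  exact ⟨by omega, by omega, fun e => h0 (Prod.ext e.1.symm e.2.symm)⟩

/-- The functional leaves only the left, lower left, lower and lower right neighbours. The lower one
dominates if it is in `X`; otherwise the left one does. -/
theorem IsExposedDisk.isDominated_of_functional_of_le (h : IsExposedDisk s X) {i : ZMod n}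
    {α β : ℝ} (hα : 0 ≤ α) (hαβ : α ≤ β)
    (hf : ∀ x ∈ X, x ≠ s i → α * x.1 + β * x.2 < α * (s i).1 + β * (s i).2) :
    IsDominated X (s i) := by
  have hS : ∀ k, s k ∈ X := fun k => h.range_subset (Set.mem_range_self k)
  have hloc : ∀ x ∈ X, c₂.Adj (s i) x → (x.1 = (s i).1 - 1 ∧ x.2 = (s i).2) ∨
      (x.2 = (s i).2 - 1 ∧ (x.1 = (s i).1 - 1 ∨ x.1 = (s i).1 ∨ x.1 = (s i).1 + 1)) := by
    intro x hx hadj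
    have hlt := hf x hx hadj.1.symm
    obtain ⟨h1, h2, h3⟩ := c₂_adj_cases hadj
    rcases h2 with h2 | h2 | h2
    · exact Or.inr ⟨h2, h1⟩
    · rcases h1 with h1 | h1 | h1
      · exact Or.inl ⟨h1, h2⟩
      · exact absurd ⟨h1, h2⟩ h3
      · rw [h1, h2] at hlt
        push_cast at hlt
        linarith
    · rcases h1 with h1 | h1 | h1 <;>
      · rw [h1, h2] at hlt
        push_cast at hlt
        linarith
  have hβ : 0 < β := by
    refine lt_of_le_of_ne (hα.trans hαβ) fun hβ => ?_
    have hα0 : α = 0 := le_antisymm (hβ ▸ hαβ) hα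
    have := hf _ (hS (i + 1)) (h.curve.adj i).1.symm
    simp [hα0, ← hβ] at this
  have hcol : ∀ x ∈ X, x.1 = (s i).1 → x.2 ≤ (s i).2 := by
    intro x hx h1
    by_contra! h2
    have := hf x hx fun e => by simp [e] at h2
    rw [h1] at this
    have h3 : ((s i).2 : ℝ) < x.2 := by exact_mod_cast h2
    have := mul_lt_mul_of_pos_left h3 hβ
    linarith
  by_cases hq : ((s i).1, (s i).2 - 1) ∈ X
  · refine ⟨_, hq, fun e => by simpa using congrArg Prod.snd e, fun x hx hadj => ?_⟩
    have := hloc x hx hadj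
    simp only [abs_le]
    omega
  have hiff : (s (i + 1)).1 = (s i).1 + 1 ↔ (s (i - 1)).1 = (s i).1 + 1 := by
    by_contra hodd
    exact hq (h.below_mem rfl rfl (fun k => hcol _ (hS k)) hodd)
  have hq' : ∀ x ∈ X, ¬ (x.1 = (s i).1 ∧ x.2 = (s i).2 - 1) := by
    rintro x hx ⟨h1, h2⟩
    exact hq (by rwa [← h1, ← h2])
  have hu := hloc _ (hS _) (h.curve.adj i)
  have hv := hloc _ (hS _) (h.curve.adj_pred i)
  have hqu := hq' _ (hS (i + 1))
  have hqv := hq' _ (hS (i - 1))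
  have huv : ¬ ((s (i + 1)).1 = (s (i - 1)).1 ∧ (s (i + 1)).2 = (s (i - 1)).2) :=
    fun e => h.prev_ne_next i (Prod.ext e.1 e.2)
  -- Only one neighbour in `X` lies in the right column, and the two curve neighbours differ, so
  -- `hiff` means neither is there. They are the left and lower left points.
  have hL : ((s i).1 - 1, (s i).2) ∈ Set.range s := by
    by_cases hu1 : (s (i + 1)).2 = (s i).2
    · exact ⟨i + 1, Prod.ext (by simp only; omega) (by simp only; omega)⟩
    · exact ⟨i - 1, Prod.ext (by simp only; omega) (by simp only; omega)⟩
  have hD : ((s i).1 - 1, (s i).2 - 1) ∈ Set.range s := by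
    by_cases hu1 : (s (i + 1)).2 = (s i).2
    · exact ⟨i - 1, Prod.ext (by simp only; omega) (by simp only; omega)⟩
    · exact ⟨i + 1, Prod.ext (by simp only; omega) (by simp only; omega)⟩
  by_cases hc : ((s i).1 + 1, (s i).2 - 1) ∈ X
  swap
  · refine ⟨_, h.range_subset hL, fun e => by simpa using congrArg Prod.fst e,
      fun x hx hadj => ?_⟩
    have h1 := hloc x hx hadj
    have h2 := hq' x hx
    have h3 : ¬ (x.1 = (s i).1 + 1 ∧ x.2 = (s i).2 - 1) := by
      rintro ⟨h1, h2⟩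
      exact hc (by rwa [← h1, ← h2])
    simp only [abs_le]
    omega
  exfalso
  have hcS : ((s i).1 + 1, (s i).2 - 1) ∈ Set.range s := by
    by_contra hcS
    exact hq (h.inner _ _ hc hcS (by simp [c₁_adj_iff]))
  obtain ⟨k, hk⟩ := hcS
  have hk1 : (s k).1 = (s i).1 + 1 := by rw [hk]
  have hk2 : (s k).2 = (s i).2 - 1 := by rw [hk]
  have hαpos : 0 < α := by
    have := hf _ (h.range_subset hL) fun e => by simpa using congrArg Prod.fst e
    push_cast at this
    linarith
  have hw : ∀ x ∈ X, c₂.Adj (s k) x → x ≠ s i →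
      (x.1 = (s k).1 + 1 ∧ x.2 = (s k).2) ∨ (x.1 = (s k).1 + 1 ∧ x.2 = (s k).2 - 1) ∨
      (x.1 = (s k).1 ∧ x.2 = (s k).2 - 1) ∨ (x.1 = (s k).1 - 1 ∧ x.2 = (s k).2 - 1) := by
    intro x hx hadj hne
    have hlt := hf x hx hne
    have hne' : ¬ (x.1 = (s i).1 ∧ x.2 = (s i).2) := fun e => hne (Prod.ext e.1 e.2)
    have hqx := hq' x hx
    obtain ⟨h1, h2, h3⟩ := c₂_adj_cases hadj
    by_cases h4 : x.2 = (s k).2 + 1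
    · rcases h1 with h1 | h1 | h1
      · omega
      · rw [h4, h1, hk1, hk2] at hlt
        push_cast at hlt
        linarith
      · rw [h4, h1, hk1, hk2] at hlt
        push_cast at hlt
        linarith
    · omega
  have hki : ∀ m, s m = s i → m + 1 ≠ k ∧ m - 1 ≠ k := by
    intro m hm
    obtain rfl := h.curve.inj hm
    refine ⟨?_, ?_⟩ <;> rintro rfl <;> omega
  have hw1 := hw _ (hS _) (h.curve.adj k) fun e => (hki _ e).2 (by simp)
  have hw2 := hw _ (hS _) (h.curve.adj_pred k) fun e => (hki _ e).1 (by simp)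
  have hw12 : ¬ ((s (k + 1)).1 = (s (k - 1)).1 ∧ (s (k + 1)).2 = (s (k - 1)).2) :=
    fun e => h.prev_ne_next k (Prod.ext e.1 e.2)
  -- None of the four directions left by `hw` are opposite, so the curve turns at `s k` and an
  -- exposing functional exists there.
  have hturn : s (k + 1) - s k ≠ s k - s (k - 1) := by
    intro e
    have e1 := congrArg Prod.fst e
    have e2 := congrArg Prod.snd e
    simp only [Prod.fst_sub, Prod.snd_sub] at e1 e2
    omega
  obtain ⟨γ, δ, hγδ⟩ := h.exposed _ (mem_segmentEndpoints_of_step_ne h.curve hturn)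
  have hb := hγδ _ (hS i) fun e => by rw [← e] at hk1; omega
  rw [hk1, hk2] at hb
  push_cast at hb
  have hγ1 := hγδ _ (hS (k + 1)) (h.curve.adj k).1.symm
  have hγ2 := hγδ _ (hS (k - 1)) (h.curve.adj_pred k).1.symm
  -- Exposure against `s i` gives `δ < γ`. This forbids a lower right step at `s k`, and the pair
  -- right and down would need `γ < 0 < δ`. So one step goes to the lower left.
  have hE : ((s i).1, (s i).2 - 2) ∈ Set.range s := by
    rcases hw1 with ⟨h1, h2⟩ | ⟨h1, h2⟩ | ⟨h1, h2⟩ | ⟨h1, h2⟩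
    rotate_right
    · exact ⟨k + 1, Prod.ext (by simp only; omega) (by simp only; omega)⟩
    all_goals
      rcases hw2 with ⟨h3, h4⟩ | ⟨h3, h4⟩ | ⟨h3, h4⟩ | ⟨h3, h4⟩
      rotate_right
      · exact ⟨k - 1, Prod.ext (by simp only; omega) (by simp only; omega)⟩
      all_goals
        first
        | omega
        | (rw [h1, h2] at hγ1
           rw [h3, h4] at hγ2
           push_cast at hγ1 hγ2
           linarith)
  -- The missing point below `s i` is now a hole enclosed by four curve points.
  obtain ⟨y, hy, hyS⟩ := h.exists_adj_notMem_range hq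
  rw [c₁_adj_iff] at hy
  simp only at hy
  have hy' : y = ((s i).1 - 1, (s i).2 - 1) ∨ y = ((s i).1 + 1, (s i).2 - 1) ∨
      y = ((s i).1, (s i).2) ∨ y = ((s i).1, (s i).2 - 2) := by
    simp only [Prod.ext_iff]
    rcases abs_cases ((s i).1 - y.1) with h1 | h1 <;>
      rcases abs_cases ((s i).2 - 1 - y.2) with h2 | h2 <;> omega
  rcases hy' with rfl | rfl | rfl | rfl
  · exact hyS hD
  · exact hyS ⟨k, hk⟩
  · exact hyS ⟨i, rfl⟩
  · exact hyS hE

theorem IsExposedDisk.isDominated_of_functional_of_nonneg (h : IsExposedDisk s X) {i : ZMod n}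
    {α β : ℝ} (hα : 0 ≤ α) (hβ : 0 ≤ β)
    (hf : ∀ x ∈ X, x ≠ s i → α * x.1 + β * x.2 < α * (s i).1 + β * (s i).2) :
    IsDominated X (s i) := by
  rcases le_total α β with hαβ | hαβ
  · exact h.isDominated_of_functional_of_le hα hαβ hf
  · refine IsDominated.of_map isSymmetry_swapAxes
      ((h.map isSymmetry_swapAxes).isDominated_of_functional_of_le hβ hαβ (i := i) ?_)
    rintro _ ⟨x, hx, rfl⟩ hne
    have := hf x hx fun e => hne (e ▸ rfl)
    simp only [Function.comp_apply, swapAxes_fst, swapAxes_snd]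
    linarith

theorem IsExposedDisk.isDominated_of_functional_of_nonneg_right (h : IsExposedDisk s X)
    {i : ZMod n} {α β : ℝ} (hβ : 0 ≤ β)
    (hf : ∀ x ∈ X, x ≠ s i → α * x.1 + β * x.2 < α * (s i).1 + β * (s i).2) :
    IsDominated X (s i) := by
  rcases le_total 0 α with hα | hα
  · exact h.isDominated_of_functional_of_nonneg hα hβ hf
  · refine IsDominated.of_map isSymmetry_negFst
      ((h.map isSymmetry_negFst).isDominated_of_functional_of_nonneg (neg_nonneg.2 hα) hβ
        (i := i) ?_)
    rintro _ ⟨x, hx, rfl⟩ hne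
    have := hf x hx fun e => hne (e ▸ rfl)
    simp only [Function.comp_apply, negFst_fst, negFst_snd, Int.cast_neg]
    linarith

theorem IsExposedDisk.isDominated_of_functional (h : IsExposedDisk s X) {i : ZMod n} {α β : ℝ}
    (hf : ∀ x ∈ X, x ≠ s i → α * x.1 + β * x.2 < α * (s i).1 + β * (s i).2) :
    IsDominated X (s i) := by
  rcases le_total 0 β with hβ | hβ
  · exact h.isDominated_of_functional_of_nonneg_right hβ hf
  · refine IsDominated.of_map isSymmetry_negSnd
      ((h.map isSymmetry_negSnd).isDominated_of_functional_of_nonneg_right (α := α)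
        (neg_nonneg.2 hβ) (i := i) ?_)
    rintro _ ⟨x, hx, rfl⟩ hne
    have := hf x hx fun e => hne (e ▸ rfl)
    simp only [Function.comp_apply, negSnd_fst, negSnd_snd, Int.cast_neg]
    linarith

theorem IsExposedDisk.isDominated_of_mem_segmentEndpoints (h : IsExposedDisk s X) {p : ℤ × ℤ}
    (hp : p ∈ segmentEndpoints s) : IsDominated X p := by
  obtain ⟨α, β, hf⟩ := h.exposed p hp
  obtain ⟨i, l, -, rfl | rfl⟩ := hp <;> exact h.isDominated_of_functional hf

/-! ### Inner points of horizontal and vertical edges are dominated -/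

/-- The only points of the curve at the height of a maximal horizontal segment are the points of
that segment. -/
theorem IsExposedDisk.exists_eq_add_of_snd_eq (h : IsExposedDisk s X) {i k : ZMod n} {l : ℕ}
    (hmax : IsMaxSegment s i l) (hhor : IsHorizontalAt s i) (hk : (s k).2 = (s i).2) :
    ∃ j ≤ l, k = i + (j : ℕ) := by
  have hS : ∀ k, s k ∈ X := fun k => h.range_subset (Set.mem_range_self k)
  have hl : (0 : ℝ) < l := by exact_mod_cast hmax.1.1
  have hseg : ∀ j ≤ l, (s (i + (j : ℕ))).1 = (s i).1 + j * ((s (i + 1)).1 - (s i).1) ∧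
      (s (i + (j : ℕ))).2 = (s i).2 := by
    intro j hj
    have hhor' : (s (i + 1)).2 = (s i).2 := hhor
    rw [hmax.1.apply hj, Prod.fst_add, Prod.snd_add, Prod.smul_fst, Prod.smul_snd]
    simp [hhor']
  -- At the height of the segment both functionals depend only on the first coordinate. Their strict
  -- maxima at opposite ends confine `s k` between those ends.
  obtain ⟨α, β, hP⟩ := h.exposed (s i) ⟨i, l, hmax, Or.inl rfl⟩
  obtain ⟨γ, δ, hQ⟩ := h.exposed (s (i + l)) ⟨i, l, hmax, Or.inr rfl⟩
  obtain ⟨hl1, hl2⟩ := hseg l le_rfl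
  by_cases hkP : s k = s i
  · exact ⟨0, Nat.zero_le _, by simpa using h.curve.inj hkP⟩
  by_cases hkQ : s k = s (i + l)
  · exact ⟨l, le_rfl, h.curve.inj hkQ⟩
  have hPQ : s (i + l) ≠ s i := by
    intro e
    have e1 : (l : ℤ) * ((s (i + 1)).1 - (s i).1) = 0 := by rw [e] at hl1; linarith
    rcases mul_eq_zero.1 e1 with e2 | e2
    · have := hmax.1.1
      omega
    · exact h.curve.step_ne_zero i (Prod.ext e2 (by simpa using sub_eq_zero.2 hhor))
  have h1 := hP _ (hS k) hkP
  have h2 := hP _ (hS (i + l)) hPQ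
  have h3 := hQ _ (hS k) hkQ
  have h4 := hQ _ (hS i) hPQ.symm
  rw [hl1, hl2] at h3 h4
  rw [hl1, hl2] at h2
  rw [hk] at h1 h3
  have hstep := (h.curve.adj i)
  have hcases := c₂_adj_cases hstep
  have hhor' : (s (i + 1)).2 = (s i).2 := hhor
  have hfin : ∀ j : ℕ, j ≤ l → (s k).1 = (s i).1 + j * ((s (i + 1)).1 - (s i).1) →
      ∃ j ≤ l, k = i + (j : ℕ) := fun j hj e =>
    ⟨j, hj, h.curve.inj (Prod.ext (e.trans (hseg j hj).1.symm) (hk.trans (hseg j hj).2.symm))⟩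
  rcases hcases.1 with he | he | he
  · rw [he] at h2 h3 h4
    push_cast at h2 h3 h4
    have hα : 0 < α := by
      by_contra! hα
      nlinarith
    have hγ : γ < 0 := by
      by_contra! hγ
      nlinarith
    have hlt1 : ((s k).1 : ℝ) < (s i).1 := by
      by_contra! hc
      nlinarith
    have hlt2 : ((s i).1 : ℝ) - l < (s k).1 := by
      by_contra! hc
      nlinarith
    have hlt1' : (s k).1 < (s i).1 := by exact_mod_cast hlt1
    have hlt2' : (s i).1 - l < (s k).1 := by exact_mod_cast hlt2
    refine hfin ((s i).1 - (s k).1).toNat (by omega) ?_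
    rw [Int.toNat_of_nonneg (by omega), he]
    ring
  · omega
  · rw [he] at h2 h3 h4
    push_cast at h2 h3 h4
    have hα : α < 0 := by
      by_contra! hα
      nlinarith
    have hγ : 0 < γ := by
      by_contra! hγ
      nlinarith
    have hlt1 : ((s i).1 : ℝ) < (s k).1 := by
      by_contra! hc
      nlinarith
    have hlt2 : ((s k).1 : ℝ) < (s i).1 + l := by
      by_contra! hc
      nlinarith
    have hlt1' : (s i).1 < (s k).1 := by exact_mod_cast hlt1
    have hlt2' : (s k).1 < (s i).1 + l := by exact_mod_cast hlt2
    refine hfin ((s k).1 - (s i).1).toNat (by omega) ?_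
    rw [Int.toNat_of_nonneg (by omega), he]
    ring

/-- The disk lies on one side of each of its maximal horizontal segments. -/
theorem IsExposedDisk.one_sided (h : IsExposedDisk s X) {i : ZMod n} {l : ℕ}
    (hmax : IsMaxSegment s i l) (hhor : IsHorizontalAt s i) :
    (∀ x ∈ X, x.2 ≤ (s i).2) ∨ ∀ x ∈ X, (s i).2 ≤ x.2 := by
  have : NeZero n := ⟨h.curve.pos⟩
  have hne : ∀ j : ℕ, l < j → j < n → (s (i + j)).2 ≠ (s i).2 := by
    intro j hlj hjn e
    obtain ⟨m, hm, e'⟩ := h.exists_eq_add_of_snd_eq hmax hhor e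
    have e1 : (j : ZMod n) = m := add_left_cancel e'
    have e2 := (ZMod.natCast_eq_natCast_iff' j m n).1 e1
    rw [Nat.mod_eq_of_lt hjn, Nat.mod_eq_of_lt (by omega)] at e2
    omega
  have hstep : ∀ j : ℕ, |(s (i + j)).2 - (s (i + (j + 1 : ℕ))).2| ≤ 1 := by
    intro j
    have := (h.curve.adj (i + j)).2.2
    rwa [add_assoc, ← Nat.cast_add_one] at this
  have hlow : ∀ j : ℕ, j ≤ l → (s (i + j)).2 = (s i).2 := by
    intro j hj
    have hhor' : (s (i + 1)).2 = (s i).2 := hhor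
    rw [hmax.1.apply hj, Prod.snd_add, Prod.smul_snd]
    simp [hhor']
  have hrep : ∀ k : ZMod n, ∃ j : ℕ, j < n ∧ k = i + j := fun k =>
    ⟨(k - i).val, ZMod.val_lt _, by simp⟩
  -- Beyond the segment, heights change by at most one per step and never equal that of the segment,
  -- so they stay on the side of the first such point.
  have hside : (∀ k, (s k).2 ≤ (s i).2) ∨ ∀ k, (s i).2 ≤ (s k).2 := by
    rcases le_total (s (i + (l + 1 : ℕ))).2 (s i).2 with hl | hl
    · left
      have key : ∀ t : ℕ, l + 1 + t < n → (s (i + (l + 1 + t : ℕ))).2 < (s i).2 := by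
        intro t
        induction t with
        | zero => exact fun ht => lt_of_le_of_ne hl (hne (l + 1) (by omega) ht)
        | succ t ih =>
          intro ht
          have h1 := ih (by omega)
          have h2 := hstep (l + 1 + t)
          have h3 := hne (l + 1 + t + 1) (by omega) ht
          rw [abs_le] at h2
          rw [← add_assoc]
          omega
      intro k
      obtain ⟨j, hj, rfl⟩ := hrep k
      rcases le_or_gt j l with hjl | hjl
      · exact (hlow j hjl).le
      · obtain ⟨t, rfl⟩ := Nat.exists_eq_add_of_le (show l + 1 ≤ j from hjl)
        exact (key t hj).le
    · right
      have key : ∀ t : ℕ, l + 1 + t < n → (s i).2 < (s (i + (l + 1 + t : ℕ))).2 := by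
        intro t
        induction t with
        | zero => exact fun ht => lt_of_le_of_ne hl (hne (l + 1) (by omega) ht).symm
        | succ t ih =>
          intro ht
          have h1 := ih (by omega)
          have h2 := hstep (l + 1 + t)
          have h3 := hne (l + 1 + t + 1) (by omega) ht
          rw [abs_le] at h2
          rw [← add_assoc]
          omega
      intro k
      obtain ⟨j, hj, rfl⟩ := hrep k
      rcases le_or_gt j l with hjl | hjl
      · exact (hlow j hjl).ge
      · obtain ⟨t, rfl⟩ := Nat.exists_eq_add_of_le (show l + 1 ≤ j from hjl)
        exact (key t hj).le
  refine hside.imp (fun hs x hx => ?_) fun hs x hx => ?_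
  · obtain ⟨k, ⟨m, hm⟩, -⟩ := h.exists_mem_range hx (d := (0, 1)) (by simp)
    have h1 := hs m
    rw [hm, Prod.snd_add, Prod.smul_snd, nsmul_eq_mul, mul_one] at h1
    omega
  · obtain ⟨k, ⟨m, hm⟩, -⟩ := h.exists_mem_range hx (d := (0, -1)) (by simp)
    have h1 := hs m
    rw [hm, Prod.snd_add, Prod.smul_snd, nsmul_eq_mul, mul_neg, mul_one] at h1
    omega

/-- An inner point of a top edge has one step to the left and one to the right, so parity puts the
point below it in `X`. All its neighbours in `X` lie at these two heights, hence within reach of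
that point. -/
theorem IsExposedDisk.isDominated_of_le (h : IsExposedDisk s X) {i : ZMod n} {l j : ℕ}
    (hmax : IsMaxSegment s i l) (hhor : IsHorizontalAt s i) (hj : 0 < j) (hjl : j < l)
    (hle : ∀ x ∈ X, x.2 ≤ (s i).2) : IsDominated X (s (i + j)) := by
  have hS : ∀ k, s k ∈ X := fun k => h.range_subset (Set.mem_range_self k)
  have hhor' : (s (i + 1)).2 = (s i).2 := hhor
  have hy : (s (i + j)).2 = (s i).2 := by
    rw [hmax.1.apply hjl.le, Prod.snd_add, Prod.smul_snd]
    simp [hhor']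
  have hnext := congrArg Prod.fst (hmax.1.2 j hjl)
  have hprev := congrArg Prod.fst (hmax.1.2 (j - 1) (by omega))
  have e1 : i + ((j - 1 : ℕ) : ZMod n) = i + j - 1 := by
    rw [Nat.cast_sub hj]
    push_cast
    ring
  rw [e1, sub_add_cancel] at hprev
  simp only [Prod.fst_sub] at hnext hprev
  have hcases := c₂_adj_cases (h.curve.adj i)
  have hq : ((s (i + j)).1, (s (i + j)).2 - 1) ∈ X := by
    refine h.below_mem rfl rfl (fun k _ => hy ▸ hle _ (hS k)) ?_
    omega
  refine ⟨_, hq, fun e => by simpa using congrArg Prod.snd e, fun x hx hadj => ?_⟩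
  have h1 := hle x hx
  have h2 := hadj.2
  simp only [abs_le] at h2 ⊢
  omega

theorem IsExposedDisk.isDominated_of_horizontal (h : IsExposedDisk s X) {i : ZMod n} {l j : ℕ}
    (hmax : IsMaxSegment s i l) (hhor : IsHorizontalAt s i) (hj : 0 < j) (hjl : j < l) :
    IsDominated X (s (i + j)) := by
  rcases h.one_sided hmax hhor with hle | hle
  · exact h.isDominated_of_le hmax hhor hj hjl hle
  · refine IsDominated.of_map isSymmetry_negSnd
      ((h.map isSymmetry_negSnd).isDominated_of_le ((isMaxSegment_comp_iff _).2 hmax) ?_ hj hjl ?_)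
    · have : (s (i + 1)).2 = (s i).2 := hhor
      simp [IsHorizontalAt, this]
    · rintro _ ⟨x, hx, rfl⟩
      simpa using hle x hx

theorem IsExposedDisk.isDominated_of_mem (h : IsExposedDisk s X) {p : ℤ × ℤ}
    (hp : p ∈ slantedEndpoints s ∪ axisPoints s) : IsDominated X p := by
  rcases hp with ⟨i, l, hmax, -, hp⟩ | ⟨i, l, hmax, hax, j, hj, rfl⟩
  · exact h.isDominated_of_mem_segmentEndpoints ⟨i, l, hmax, hp⟩
  · rcases Nat.eq_zero_or_pos j with rfl | hj0
    · exact h.isDominated_of_mem_segmentEndpoints ⟨i, l, hmax, Or.inl (by simp)⟩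
    rcases hj.eq_or_lt with rfl | hjl
    · exact h.isDominated_of_mem_segmentEndpoints ⟨i, j, hmax, Or.inr rfl⟩
    rcases hax with hhor | hver
    · exact h.isDominated_of_horizontal hmax hhor hj0 hjl
    · refine IsDominated.of_map isSymmetry_swapAxes
        ((h.map isSymmetry_swapAxes).isDominated_of_horizontal ((isMaxSegment_comp_iff _).2 hmax)
          ?_ hj0 hjl)
      exact hver

end DigitalPlane

theorem theorem4p3 (X : Set (ℤ × ℤ)) (hthick : DigitalPlane.IsThick X)
    (n : ℕ) (s : ZMod n → ℤ × ℤ) (hconv : DigitalPlane.IsConvexDisk s X) :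
    DigitalPlane.IsMinimalFreezing DigitalPlane.c₂ X
      (DigitalPlane.slantedEndpoints s ∪ DigitalPlane.axisPoints s) := by
  have h := hconv.isExposedDisk
  exact ⟨h.isFreezing, fun A hA _ b hb =>
    (h.isDominated_of_mem hb).mem_of_isFreezing (h.boundary_subset hb) hA⟩
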